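/- Let $X$ be a finite set with $n$ elements, and let $S : X\times X\to X\times X$ be a map, written $S(x,y)=(g_x(y),f_y(x))$ with maps $g_x, f_x : X\to X$ for $x\in X$. Assume that $(X,S)$ is a non-degenerate symmetric set-theoretical solution of the quantum Yang--Baxter equation, that is: - all the maps $g_x$ and $f_x$ are bijective; - $S$ is involutive: $S\circ S=\mathrm{Id}_{X\times X}$; - $S$ is braided: $S^{12}S^{23}S^{12}=S^{23}S^{12}S^{23}$ on $X^3$, where $S^{i\,i+1}$ means $S$ acting on the $i$-th and $(i+1)$-th components. The structure group of $(X,S)$ is $$G(X,S)=\langle\, X \mid xy=g_x(y)f_y(x)\ ;\ x,y\in X,\ S(x,y)\neq(x,y)\,\rangle .$$ Let $V$ be a real vector space having $X$ as a basis, put $\varphi_x=f_x^{-1}$, and let $\psi_x\in GL(V)$ be the linear map with $\psi_x(y)=\varphi_x(y)$ for $y\in X$, $y\neq x$, and $\psi_x(x)=-\varphi_x(x)$. The map $x\mapsto\psi_x$ extends to a group homomorphism $\psi: G(X,S)\to GL(V)$; let $W(X,S)=\psi(G(X,S))$ be its image, and let $\mathbf X=\{\psi_x\mid x\in X\}\subseteq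 W(X,S)$. A pair $(x,y)\in X\times X$ is called frozen if $S(x,y)=(x,y)$. One says that $(X,S)$ verifies Property $(\mathcal C)$ if $g_x\circ g_y=\mathrm{Id}_X$ and $f_y\circ f_x=\mathrm{Id}_X$ for every frozen pair $(x,y)$. If $(X,S)$ verifies Property $(\mathcal C)$, then: 1. the group $W(X,S)$ has the group presentation $$\left\langle\ \mathbf X\ \left|\ \begin{array}{lcl}\psi_x\psi_y=\psi_z\psi_t&;&x,y\in X,\ S(x,y)=(z,t)\neq(x,y)\\ \psi_x\psi_y=1&;&x,y\in X,\ S(x,y)=(x,y)\end{array}\right.\right\rangle ,$$ that is, the inclusion $\mathbf X\subseteq W(X,S)$ induces an isomorphism from the group so presented onto $W(X,S)$; 2. $W(X,S)$ is a finite group of order $2^n$. -/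

import Mathlib

universe u v

namespace YangBaxter

section Maps

variable {X : Type u} (S : X × X → X × X)

/-- `g_x`, the first component: `S (x, y) = (g_x y, f_y x)`. -/
def gMap (x : X) : X → X := fun y => (S (x, y)).1

/-- `f_y`, the second component: `S (x, y) = (g_x y, f_y x)`. -/
def fMap (y : X) : X → X := fun x => (S (x, y)).2

/-- `S` acting on the first and second components of `X³`. -/
def map12 : X × X × X → X × X × X :=
  fun p => ((S (p.1, p.2.1)).1, (S (p.1, p.2.1)).2, p.2.2)

/-- `S` acting on the second and third components of `X³`. -/
def map23 : X × X × X → X × X × X := fun p => (p.1, S p.2)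

/-- All the maps `f_x` and `g_x` are bijections. -/
def Nondegenerate : Prop :=
  ∀ x : X, Function.Bijective (fMap S x) ∧ Function.Bijective (gMap S x)

/-- `S¹² S²³ S¹² = S²³ S¹² S²³`. -/
def Braided : Prop :=
  map12 S ∘ map23 S ∘ map12 S = map23 S ∘ map12 S ∘ map23 S

/-- Symmetric means involutive and braided. -/
def Symmetric : Prop := S ∘ S = id ∧ Braided S

/-- `(x, y)` is a frozen pair if `S (x, y) = (x, y)`. -/
def Frozen (x y : X) : Prop := S (x, y) = (x, y)

/-- Property (C) for a pair `(x, y)`. -/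
def PropertyCPair (x y : X) : Prop :=
  gMap S x ∘ gMap S y = id ∧ fMap S y ∘ fMap S x = id

/-- Property (C) for `(X, S)`: it holds for each frozen pair. -/
def PropertyC : Prop := ∀ x y : X, Frozen S x y → PropertyCPair S x y

/-- The relations `x y = g_x(y) f_y(x)` for `S (x, y) ≠ (x, y)`, as elements of the free group. -/
def structureRels : Set (FreeGroup X) :=
  {r | ∃ x y : X, S (x, y) ≠ (x, y) ∧
    r = FreeGroup.of x * FreeGroup.of y *
      (FreeGroup.of (gMap S x y) * FreeGroup.of (fMap S y x))⁻¹}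

/-- The structure group `G(X, S)`. -/
abbrev StructureGroup : Type u := PresentedGroup (structureRels S)

end Maps

section Rep

variable {X : Type u} {S : X × X → X × X} {V : Type v} [AddCommGroup V] [Module ℝ V]

/-- `φ_x = f_x⁻¹`, as a permutation of `X`. -/
noncomputable def phi (hS : Nondegenerate S) (x : X) : Equiv.Perm X :=
  (Equiv.ofBijective (fMap S x) (hS x).1).symm

open Classical in
/-- `ψ_x` on basis vectors: `ψ_x(y) = φ_x(y)` for `y ≠ x` and `ψ_x(x) = -φ_x(x)`. -/
noncomputable def psiVec (hS : Nondegenerate S) (b : Module.Basis X ℝ V) (x y : X) : V :=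
  if y = x then -b (phi hS x y) else b (phi hS x y)

open Classical in
/-- The values on basis vectors of the inverse of `ψ_x`. -/
noncomputable def psiInvVec (hS : Nondegenerate S) (b : Module.Basis X ℝ V) (x z : X) : V :=
  if (phi hS x).symm z = x then -b ((phi hS x).symm z) else b ((phi hS x).symm z)

/-- The linear automorphism `ψ_x` of `V`, where `X` is viewed as a basis of `V` through `b`. -/
noncomputable def psi (hS : Nondegenerate S) (b : Module.Basis X ℝ V) (x : X) :
    LinearMap.GeneralLinearGroup ℝ V where
  val := b.constr ℝ (psiVec hS b x)
  inv := b.constr ℝ (psiInvVec hS b x)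
  val_inv := by
    refine b.ext fun z => ?_
    by_cases h : (phi hS x).symm z = x
    · have h' : z = phi hS x x := (Equiv.symm_apply_eq _).1 h
      simp [Module.End.mul_apply, psiVec, psiInvVec, h']
    · simp [Module.End.mul_apply, psiVec, psiInvVec, h]
  inv_val := by
    refine b.ext fun z => ?_
    by_cases h : z = x <;> simp [Module.End.mul_apply, psiVec, psiInvVec, h]

open Classical in
theorem psi_basis (hS : Nondegenerate S) (b : Module.Basis X ℝ V) (x y : X) :
    (psi hS b x : V →ₗ[ℝ] V) (b y) = if y = x then -b (phi hS x y) else b (phi hS x y) := by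
  simp [psi, psiVec]

theorem phi_eq_iff (hS : Nondegenerate S) (x y z : X) : phi hS x y = z ↔ fMap S x z = y := by
  rw [phi, Equiv.symm_apply_eq]
  exact eq_comm

theorem phi_phi (hS : Nondegenerate S) (hsym : Symmetric S) (x y w : X) :
    phi hS x (phi hS y w) = phi hS (gMap S x y) (phi hS (fMap S y x) w) := by
  rw [phi_eq_iff]
  symm
  rw [phi_eq_iff]
  set a := phi hS (gMap S x y) (phi hS (fMap S y x) w) with ha
  have h1 : fMap S (gMap S x y) a = phi hS (fMap S y x) w := (phi_eq_iff hS _ _ _).1 ha.symm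
  have h2 : fMap S (fMap S y x) (fMap S (gMap S x y) a) = w := (phi_eq_iff hS _ _ _).1 h1.symm
  have h3 := congrArg (fun p : X × X × X => p.2.2) (congrFun hsym.2 (a, x, y))
  exact h3.trans h2

/-- The maps `ψ_x` satisfy the defining relations of the structure group. -/
theorem psi_rel (hS : Nondegenerate S) (hsym : Symmetric S) (b : Module.Basis X ℝ V) (x y : X)
    (hxy : S (x, y) ≠ (x, y)) :
    psi hS b x * psi hS b y = psi hS b (gMap S x y) * psi hS b (fMap S y x) := by
  classical
  have key : ∀ x y : X, fMap S (fMap S y x) (gMap S x y) = y := fun x y =>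
    congrArg Prod.snd (congrFun hsym.1 (x, y))
  have hne : fMap S y x ≠ y := by
    intro h
    apply hxy
    have h1 := key x y
    rw [h] at h1
    have h2 : gMap S x y = x := (hS y).1.1 (h1.trans h.symm)
    exact Prod.ext h2 h
  ext1
  refine b.ext fun w => ?_
  have hpp := phi_phi hS hsym x y w
  have e1 : phi hS y w = x ↔ w = fMap S y x := by
    rw [phi_eq_iff]; exact eq_comm
  have e2 : phi hS (fMap S y x) w = gMap S x y ↔ w = y := by
    rw [phi_eq_iff, key x y]; exact eq_comm
  simp only [Units.val_mul, Module.End.mul_apply, psi_basis]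
  by_cases h1 : w = y
  · have h2 : w ≠ fMap S y x := fun h => hne (h ▸ h1)
    rw [if_pos h1, if_neg h2, map_neg, psi_basis, psi_basis, if_neg (fun h => h2 (e1.1 h)),
      if_pos (e2.2 h1), hpp]
  · by_cases h2 : w = fMap S y x
    · rw [if_neg h1, if_pos h2, map_neg, psi_basis, psi_basis, if_pos (e1.2 h2),
        if_neg (fun h => h1 (e2.1 h)), hpp]
    · rw [if_neg h1, if_neg h2, psi_basis, psi_basis, if_neg (fun h => h2 (e1.1 h)),
        if_neg (fun h => h1 (e2.1 h)), hpp]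

theorem lift_psi_rels (hS : Nondegenerate S) (hsym : Symmetric S) (b : Module.Basis X ℝ V) :
    ∀ r ∈ structureRels S, FreeGroup.lift (psi hS b) r = 1 := by
  rintro r ⟨x, y, hxy, rfl⟩
  simp only [map_mul, map_inv, FreeGroup.lift_apply_of]
  rw [mul_inv_eq_one]
  exact psi_rel hS hsym b x y hxy

/-- The linear representation `ψ : G(X, S) → GL(V)` sending `x` to `ψ_x`. -/
noncomputable def psiHom (hS : Nondegenerate S) (hsym : Symmetric S) (b : Module.Basis X ℝ V) :
    StructureGroup S →* LinearMap.GeneralLinearGroup ℝ V :=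
  PresentedGroup.toGroup (lift_psi_rels hS hsym b)

/-- The group `W(X, S) = ψ(G(X, S))`. -/
noncomputable def W (hS : Nondegenerate S) (hsym : Symmetric S) (b : Module.Basis X ℝ V) :
    Subgroup (LinearMap.GeneralLinearGroup ℝ V) :=
  (psiHom hS hsym b).range

/-- `ψ_x` as an element of `W(X, S)`. -/
noncomputable def psiW (hS : Nondegenerate S) (hsym : Symmetric S) (b : Module.Basis X ℝ V)
    (x : X) : W hS hsym b :=
  ⟨psi hS b x, PresentedGroup.of x, PresentedGroup.toGroup.of (lift_psi_rels hS hsym b)⟩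

/-- The generating set `{ψ_x | x ∈ X}` of `W(X, S)`. -/
def boldX (hS : Nondegenerate S) (hsym : Symmetric S) (b : Module.Basis X ℝ V) :
    Set (W hS hsym b) :=
  Set.range (psiW hS hsym b)

/-- The free generator attached to `ψ_x`. -/
noncomputable def gen (hS : Nondegenerate S) (hsym : Symmetric S) (b : Module.Basis X ℝ V)
    (x : X) : FreeGroup (boldX hS hsym b) :=
  FreeGroup.of ⟨psiW hS hsym b x, x, rfl⟩

/-- The relations `ψ_x ψ_y = ψ_z ψ_t` for `S (x, y) = (z, t) ≠ (x, y)`, and `ψ_x ψ_y = 1` for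
`S (x, y) = (x, y)`, as elements of the free group on `{ψ_x | x ∈ X}`. -/
def quotientRels (hS : Nondegenerate S) (hsym : Symmetric S) (b : Module.Basis X ℝ V) :
    Set (FreeGroup (boldX hS hsym b)) :=
  {r | ∃ x y z t : X, S (x, y) = (z, t) ∧ (z, t) ≠ (x, y) ∧
    r = gen hS hsym b x * gen hS hsym b y * (gen hS hsym b z * gen hS hsym b t)⁻¹} ∪
  {r | ∃ x y : X, Frozen S x y ∧ r = gen hS hsym b x * gen hS hsym b y}

end Rep

end YangBaxter

namespace YangBaxter

section Combinatorics

variable {X : Type u} {S : X × X → X × X}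

theorem fMap_gMap (hsym : Symmetric S) (x y : X) : fMap S (fMap S y x) (gMap S x y) = y :=
  congrArg Prod.snd (congrFun hsym.1 (x, y))

theorem fMap_phi (hS : Nondegenerate S) (x y : X) : fMap S x (phi hS x y) = y :=
  (phi_eq_iff hS x y _).1 rfl

/-- `S` exchanges `(φ_y(x), y)` and `(φ_x(y), x)`. -/
theorem apply_phi_pair (hS : Nondegenerate S) (hsym : Symmetric S) (x y : X) :
    S (phi hS y x, y) = (phi hS x y, x) := by
  have h2 : fMap S y (phi hS y x) = x := fMap_phi hS y x
  have h1 := fMap_gMap hsym (phi hS y x) y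
  rw [h2] at h1
  exact Prod.ext ((phi_eq_iff hS _ _ _).2 h1).symm h2

theorem frozen_phi_self (hS : Nondegenerate S) (hsym : Symmetric S) (x : X) :
    Frozen S (phi hS x x) x :=
  apply_phi_pair hS hsym x x

theorem Frozen.phi_self {x y : X} (h : Frozen S x y) (hS : Nondegenerate S) :
    phi hS y y = x :=
  (phi_eq_iff hS _ _ _).2 (congrArg Prod.snd h)

theorem phi_phi_of_frozen (hS : Nondegenerate S) (hC : PropertyC S) {x y : X}
    (h : Frozen S x y) (w : X) : phi hS x (phi hS y w) = w := by
  rw [phi_eq_iff]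
  symm
  rw [phi_eq_iff]
  exact congrFun (hC x y h).2 w

/-- A group generated by elements satisfying the relations of `G(X, S)` together with
`x y = 1` for frozen pairs, and acting on `X` through `φ`, is enumerated by the subsets of `X`. -/
theorem exists_surjective_finset {G : Type*} [Group G] (hS : Nondegenerate S)
    (hsym : Symmetric S) (q : X → G) (hq : Subgroup.closure (Set.range q) = ⊤)
    (hne : ∀ x y, S (x, y) ≠ (x, y) → q x * q y = q (gMap S x y) * q (fMap S y x))
    (hfr : ∀ x y, Frozen S x y → q x * q y = 1)
    (φ : G →* Equiv.Perm X) (hφ : ∀ x, φ (q x) = phi hS x) :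
    ∃ u : Finset X → G, Function.Surjective u := by
  classical
  let T : X → G → G := fun a g => q (φ g a) * g
  have hTT : ∀ a b g, T a (T b g) =
      q (phi hS (φ g b) (φ g a)) * q (φ g b) * g := by
    intro a b g
    simp only [T, map_mul, hφ, Equiv.Perm.mul_apply, mul_assoc]
  have hcomm : ∀ a b g, T a (T b g) = T b (T a g) := by
    intro a b g
    rw [hTT, hTT]
    congr 1
    set x := φ g a
    set y := φ g b
    have h := apply_phi_pair hS hsym x y
    by_cases hxy : S (phi hS y x, y) = (phi hS y x, y)
    · have hx : x = y := by rw [h] at hxy; exact congrArg Prod.snd hxy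
      rw [hx]
    · have := hne _ _ hxy
      have h1 : gMap S (phi hS y x) y = phi hS x y := congrArg Prod.fst h
      have h2 : fMap S y (phi hS y x) = x := congrArg Prod.snd h
      rwa [h1, h2] at this
  have hinv : ∀ a g, T a (T a g) = g := by
    intro a g
    rw [hTT, hfr _ _ (frozen_phi_self hS hsym _), one_mul]
  have : LeftCommutative T := ⟨hcomm⟩
  refine ⟨fun A => A.val.foldr T 1, ?_⟩
  have hT : ∀ a, ∀ A : Finset X, ∃ B : Finset X,
      B.val.foldr T 1 = T a (A.val.foldr T 1) := by
    intro a A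
    by_cases ha : a ∈ A
    · refine ⟨A.erase a, ?_⟩
      conv_rhs => rw [← Finset.insert_erase ha, Finset.insert_val_of_notMem (Finset.notMem_erase a A),
        Multiset.foldr_cons, hinv]
    · exact ⟨insert a A, by rw [Finset.insert_val_of_notMem ha, Multiset.foldr_cons]⟩
  have hmul : ∀ y g, (∃ A : Finset X, A.val.foldr T 1 = g) →
      ∃ A : Finset X, A.val.foldr T 1 = q y * g := by
    rintro y _ ⟨A, rfl⟩
    obtain ⟨B, hB⟩ := hT ((φ (A.val.foldr T 1)).symm y) A
    exact ⟨B, by rw [hB]; simp [T]⟩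
  intro g
  have hg : g ∈ Subgroup.closure (Set.range q) := hq ▸ Subgroup.mem_top g
  induction hg using Subgroup.closure_induction_left with
  | one => exact ⟨∅, rfl⟩
  | mul_left x hx y _ ih =>
    obtain ⟨x, rfl⟩ := hx
    exact hmul x y ih
  | inv_mul_cancel x hx y _ ih =>
    obtain ⟨x, rfl⟩ := hx
    have h : (q x)⁻¹ = q (phi hS x x) :=
      (eq_inv_of_mul_eq_one_left (hfr _ _ (frozen_phi_self hS hsym x))).symm
    rw [h]
    exact hmul _ y ih

end Combinatorics

section Representation

variable {X : Type u} {S : X × X → X × X} {V : Type v} [AddCommGroup V] [Module ℝ V]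

theorem neg_basis_ne_basis (b : Module.Basis X ℝ V) (x y : X) : -b x ≠ b y := by
  classical
  intro h
  have h1 := congrArg (fun v => b.repr v x) h
  simp only [map_neg, Module.Basis.repr_self, Finsupp.neg_apply, Finsupp.single_apply] at h1
  split_ifs at h1 <;> norm_num at h1

theorem psiW_injective (hS : Nondegenerate S) (hsym : Symmetric S) (b : Module.Basis X ℝ V) :
    Function.Injective (psiW hS hsym b) := by
  intro x y h
  by_contra hxy
  have h1 : psi hS b x = psi hS b y := congrArg Subtype.val h
  have h2 := psi_basis hS b x x
  rw [h1, psi_basis, if_neg hxy, if_pos rfl] at h2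
  exact neg_basis_ne_basis b _ _ h2.symm

theorem psi_mul_psi_of_frozen (hS : Nondegenerate S) (b : Module.Basis X ℝ V)
    (hC : PropertyC S) {x y : X} (h : Frozen S x y) : psi hS b x * psi hS b y = 1 := by
  classical
  ext1
  refine b.ext fun w => ?_
  have e : phi hS y w = x ↔ w = y := by
    rw [← h.phi_self hS, (phi hS y).injective.eq_iff]
  have hpp := phi_phi_of_frozen hS hC h w
  rw [Units.val_mul, Module.End.mul_apply, psi_basis]
  by_cases hw : w = y
  · rw [if_pos hw, map_neg, psi_basis, if_pos (e.2 hw), hpp]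
    simp
  · rw [if_neg hw, psi_basis, if_neg (fun h' => hw (e.1 h')), hpp]
    simp

/-- Every pattern of signs occurs in `W(X, S)`. -/
theorem exists_mem_W_sign (hS : Nondegenerate S) (hsym : Symmetric S) (b : Module.Basis X ℝ V)
    [DecidableEq X] (A : Finset X) : ∃ g : W hS hsym b, ∃ π : Equiv.Perm X, ∀ w,
      ((g : LinearMap.GeneralLinearGroup ℝ V) : V →ₗ[ℝ] V) (b w) =
        if w ∈ A then -b (π w) else b (π w) := by
  induction A using Finset.induction_on with
  | empty => exact ⟨1, 1, fun w => by simp⟩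
  | insert a A ha ih =>
    obtain ⟨g, π, hg⟩ := ih
    refine ⟨psiW hS hsym b (π a) * g, phi hS (π a) * π, fun w => ?_⟩
    have hval : ((psiW hS hsym b (π a) : W hS hsym b) : LinearMap.GeneralLinearGroup ℝ V) =
      psi hS b (π a) := rfl
    rw [Subgroup.coe_mul, hval, Units.val_mul, Module.End.mul_apply, hg]
    by_cases hw : w = a
    · subst hw
      simp [ha, psi_basis]
    · by_cases hA : w ∈ A <;> simp [hA, hw, psi_basis]

theorem exists_injective_finset_W (hS : Nondegenerate S) (hsym : Symmetric S)
    (b : Module.Basis X ℝ V) : ∃ s : Finset X → W hS hsym b, Function.Injective s := by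
  classical
  choose s π hs using exists_mem_W_sign hS hsym b
  refine ⟨s, fun A B h => Finset.ext fun w => ?_⟩
  have hA := hs A w
  rw [h, hs B w] at hA
  by_cases h1 : w ∈ A <;> by_cases h2 : w ∈ B <;> simp only [h1, h2, if_true, if_false] at hA ⊢
  · exact (neg_basis_ne_basis b _ _ hA.symm).elim
  · exact (neg_basis_ne_basis b _ _ hA).elim

/-- A family of elements of a group satisfying the relations of `quotientRels` respects them as
elements of the free group. -/
theorem lift_quotientRels (hS : Nondegenerate S) (hsym : Symmetric S) (b : Module.Basis X ℝ V)
    {G : Type*} [Group G] (p : X → G) (k : boldX hS hsym b → G)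
    (hk : ∀ x, k ⟨psiW hS hsym b x, x, rfl⟩ = p x)
    (hne : ∀ x y, S (x, y) ≠ (x, y) → p x * p y = p (gMap S x y) * p (fMap S y x))
    (hfr : ∀ x y, Frozen S x y → p x * p y = 1) :
    ∀ r ∈ quotientRels hS hsym b, FreeGroup.lift k r = 1 := by
  rintro r (⟨x, y, z, t, h, hzt, rfl⟩ | ⟨x, y, h, rfl⟩)
  · have hz : gMap S x y = z := congrArg Prod.fst h
    have ht : fMap S y x = t := congrArg Prod.snd h
    have := hne x y (h ▸ hzt)
    rw [hz, ht] at this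
    simp only [gen, map_mul, map_inv, FreeGroup.lift_apply_of, hk]
    rw [mul_inv_eq_one, this]
  · simp only [gen, map_mul, FreeGroup.lift_apply_of, hk]
    exact hfr x y h

theorem exists_surjective_finset_presented (hS : Nondegenerate S) (hsym : Symmetric S)
    (b : Module.Basis X ℝ V) (hC : PropertyC S) :
    ∃ u : Finset X → PresentedGroup (quotientRels hS hsym b), Function.Surjective u := by
  have hinj := psiW_injective hS hsym b
  let k : boldX hS hsym b → Equiv.Perm X := fun w => phi hS w.2.choose
  have hk : ∀ x, k ⟨psiW hS hsym b x, x, rfl⟩ = phi hS x := fun x => by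
    have hx : ∃ y, psiW hS hsym b y = psiW hS hsym b x := ⟨x, rfl⟩
    exact congrArg (phi hS) (hinj hx.choose_spec)
  have hrels := lift_quotientRels hS hsym b (phi hS) k hk
    (fun x y _ => Equiv.ext (phi_phi hS hsym x y))
    (fun x y h => Equiv.ext (phi_phi_of_frozen hS hC h))
  refine exists_surjective_finset hS hsym
    (fun x => PresentedGroup.mk (quotientRels hS hsym b) (gen hS hsym b x)) ?_ ?_ ?_
    (PresentedGroup.toGroup hrels) ?_
  · rw [← PresentedGroup.closure_range_of (quotientRels hS hsym b)]
    congr 1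
    ext g
    constructor
    · rintro ⟨x, rfl⟩
      exact ⟨_, rfl⟩
    · rintro ⟨⟨_, x, rfl⟩, rfl⟩
      exact ⟨x, rfl⟩
  · intro x y hxy
    rw [← map_mul, ← map_mul, ← mul_inv_eq_one, ← map_inv, ← map_mul]
    exact PresentedGroup.one_of_mem (Or.inl ⟨x, y, _, _, rfl, hxy, rfl⟩)
  · intro x y h
    rw [← map_mul]
    exact PresentedGroup.one_of_mem (Or.inr ⟨x, y, h, rfl⟩)
  · intro x
    exact (PresentedGroup.toGroup.of hrels).trans (hk x)

theorem lift_boldX_quotientRels (hS : Nondegenerate S) (hsym : Symmetric S)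
    (b : Module.Basis X ℝ V) (hC : PropertyC S) :
    ∀ r ∈ quotientRels hS hsym b,
      FreeGroup.lift (fun w : boldX hS hsym b => (w : W hS hsym b)) r = 1 :=
  lift_quotientRels hS hsym b (psiW hS hsym b) _ (fun _ => rfl)
    (fun x y h => Subtype.ext (psi_rel hS hsym b x y h))
    (fun _ _ h => Subtype.ext (psi_mul_psi_of_frozen hS b hC h))

theorem closure_boldX (hS : Nondegenerate S) (hsym : Symmetric S) (b : Module.Basis X ℝ V) :
    Subgroup.closure (boldX hS hsym b) = ⊤ := by
  let f : StructureGroup S →* W hS hsym b := (psiHom hS hsym b).rangeRestrict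
  have hf : f.range = ⊤ := 
    MonoidHom.range_eq_top.2 (psiHom hS hsym b).rangeRestrict_surjective
  have h : boldX hS hsym b = f '' Set.range PresentedGroup.of := by
    rw [← Set.range_comp]
    exact congrArg Set.range (funext fun x => Subtype.ext
      (PresentedGroup.toGroup.of (lift_psi_rels hS hsym b)).symm)
  rw [h, ← MonoidHom.map_closure, PresentedGroup.closure_range_of, ← MonoidHom.range_eq_map, hf]

theorem toGroup_boldX_surjective (hS : Nondegenerate S) (hsym : Symmetric S)
    (b : Module.Basis X ℝ V) (hC : PropertyC S) :
    Function.Surjective (PresentedGroup.toGroup (lift_boldX_quotientRels hS hsym b hC)) := by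
  rw [← MonoidHom.range_eq_top, eq_top_iff, ← closure_boldX hS hsym b, Subgroup.closure_le]
  intro w hw
  exact ⟨PresentedGroup.of ⟨w, hw⟩,
    PresentedGroup.toGroup.of (lift_boldX_quotientRels hS hsym b hC)⟩

end Representation

end YangBaxter

open YangBaxter in
theorem mainTheorem4 {X : Type u} [Finite X] (S : X × X → X × X)
    (hnd : YangBaxter.Nondegenerate S) (hsym : YangBaxter.Symmetric S)
    {V : Type v} [AddCommGroup V] [Module ℝ V] (b : Module.Basis X ℝ V)
    (hC : YangBaxter.PropertyC S) :
    (∃ e : PresentedGroup (YangBaxter.quotientRels hnd hsym b) ≃* YangBaxter.W hnd hsym b,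
      ∀ w : YangBaxter.boldX hnd hsym b, e (PresentedGroup.of w) = (w : YangBaxter.W hnd hsym b)) ∧
    Nat.card (YangBaxter.W hnd hsym b) = 2 ^ Nat.card X := by
  obtain ⟨u, hu⟩ := exists_surjective_finset_presented hnd hsym b hC
  obtain ⟨s, hs⟩ := exists_injective_finset_W hnd hsym b
  have hrels := lift_boldX_quotientRels hnd hsym b hC
  let F := PresentedGroup.toGroup hrels
  have hF : Function.Surjective F := toGroup_boldX_surjective hnd hsym b hC
  have : Finite (PresentedGroup (quotientRels hnd hsym b)) := Finite.of_surjective u hu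
  have : Finite (W hnd hsym b) := Finite.of_surjective F hF
  have hcard : Nat.card (Finset X) = 2 ^ Nat.card X := by
    have := Fintype.ofFinite X
    simp [Nat.card_eq_fintype_card]
  have h1 := Nat.card_le_card_of_surjective u hu
  have h2 := Nat.card_le_card_of_surjective F hF
  have h3 := Nat.card_le_card_of_injective s hs
  have hbij : Function.Bijective F :=
    (Nat.bijective_iff_surjective_and_card F).2 ⟨hF, by omega⟩
  exact ⟨⟨MulEquiv.ofBijective F hbij, fun w => PresentedGroup.toGroup.of hrels⟩, by omega⟩
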